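/- For $\xi,\mu\in\mathbb R$ and $\sigma>0$ let $G_{\mu,\sigma,\xi}$ be the distribution function of the generalized extreme value (GEV) distribution for minima with location $\mu$, scale $\sigma$ and shape $\xi$, $$G_{\mu,\sigma,\xi}(z)=1-\exp\Big\{-\Big[1-\xi\,\frac{z-\mu}{\sigma}\Big]^{-1/\xi}\Big\}\qquad\text{if } 1-\xi\,\frac{z-\mu}{\sigma}>0 ;$$ at the remaining $z$ it equals $1$ if $\xi>0$ and $0$ if $\xi<0$. For $s>0$ let $H_{\xi,s}$ be the distribution function of the generalized Pareto distribution (GPD) with shape $\xi$ and scale $s$: $H_{\xi,s}(y)=0$ for $y\le 0$, and for $y>0$ $$H_{\xi,s}(y)=1-\Big[1+\frac{\xi y}{s}\Big]^{-1/\xi}\ \text{ if } 1+\frac{\xi y}{s}>0,\qquad H_{\xi,s}(y)=1\ \text{ otherwise.}$$ For $\xi=0$ both are understood as limits $\xi\to0$: $G_{\mu,\sigma,0}(z)=1-\exp(-e^{(z-\mu)/\sigma})$, and $H_{0,s}(y)=1-e^{-y/s}$ for $y>0$. **Theorem 1.** Let $X_1,X_2,\dots$ be independent real random variables with common distribution function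 $F$, and let $m_n=\min\{X_1,\dots,X_n\}$. Suppose that the distribution of $m_n$ is asymptotically GEV with parameters $\mu_n\in\mathbb R$, $\sigma_n>0$ and $\xi\in\mathbb R$, that is, $$\lim_{n\to\infty}\Pr\{m_n\le \mu_n+\sigma_n x\}=G_{0,1,\xi}(x)\qquad\text{for every } x\in\mathbb R .$$ Let $X$ be any one of the $X_i$, and put $\tilde\sigma_{u,n}=\sigma_n-\xi(u-\mu_n)$. Then, for low enough thresholds $u$, the conditional distribution of the shortfall $u-X$ given $X<u$ is approximated, uniformly and with arbitrarily small error, by the GPD with shape $\xi$ and scale $\tilde\sigma_{u,n}$, where $n$ is any sample size of the order of $1/\Pr\{X<u\}$. Precisely: for all $0<c\le C$ and every $\varepsilon>0$ there is a $u_0$ with $\Pr\{X<u_0\}>0$ such that, for every $u\le u_0$ with $\Pr\{X<u\}>0$ and every $n$ with $c\le n\Pr\{X<u\}\le C$, $$\tilde\sigma_{u,n}>0\qquad\text{and}\qquad \sup_{y\in\mathbb R}\big|\Pr\{u-X<y\mid X<u\}-H_{\xi,\tilde\sigma_{u,n}}(y)\big|\le\varepsilon .$$ (When $c\le1$ and $C\ge2$,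 the choice $n=\lceil 1/\Pr\{X<u\}\rceil$ is allowed for every such $u$.) -/

import Mathlib

open MeasureTheory ProbabilityTheory Filter Topology

/-- The distribution function of the generalized extreme value distribution for minima, with
location `μ`, scale `σ > 0` and shape `ξ`. Where `1 - ξ (z - μ) / σ > 0` it is
`1 - exp (-(1 - ξ (z - μ) / σ) ^ (-1 / ξ))`; a point `z` where this fails lies above the support
if `ξ > 0` and below the support if `ξ < 0`. The case `ξ = 0` is the limit `ξ → 0`. -/
noncomputable def gevMinCDF (μ σ ξ z : ℝ) : ℝ :=
  if ξ = 0 then 1 - Real.exp (-Real.exp ((z - μ) / σ))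
  else if 0 < 1 - ξ * ((z - μ) / σ) then
    1 - Real.exp (-(1 - ξ * ((z - μ) / σ)) ^ (-1 / ξ))
  else if 0 < ξ then 1 else 0

/-- The distribution function of the generalized Pareto distribution with shape `ξ` and scale
`s > 0`. For `y > 0` it is `1 - (1 + ξ y / s) ^ (-1 / ξ)` where `1 + ξ y / s > 0`, and `1` where
this fails (which needs `ξ < 0`, and then `y` lies above the support). The case `ξ = 0` is the
limit `ξ → 0`. -/
noncomputable def gpdCDF (ξ s y : ℝ) : ℝ :=
  if y ≤ 0 then 0
  else if ξ = 0 then 1 - Real.exp (-y / s)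
  else if 0 < 1 + ξ * y / s then 1 - (1 + ξ * y / s) ^ (-1 / ξ)
  else 1

/-- The scale of the generalized Pareto distribution at threshold `u` that belongs to the
generalized extreme value distribution for minima with parameters `μ`, `σ`, `ξ`. -/
def gpdScale (μ σ ξ u : ℝ) : ℝ := σ - ξ * (u - μ)

/-! Write `Λ` for `gevMinExponent ξ`. Since the minimum exceeds `z` with probability `(1 - F z) ^
n`, the hypothesis amounts to `n F(μ n + σ n x) → Λ x`. Monotonicity makes this uniform on
half-lines where `Λ` is bounded, also for left limits (`eventually_gevMinExponent_bounds`). With `u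
= μ n + σ n x`, the conditional tail is `F(u - y) / P(X < u)`. Multiplying both terms by `n` turns
it nearly into a ratio of values of `Λ`, which is exactly a GPD tail (`gevMinExponent_sub_mul`). The
bound `c ≤ n P(X < u)` keeps the denominator away from zero, `n P(X < u) ≤ C` keeps `x` in the
uniform range, and a low `u` forces `n` to be large. -/

/-! ### The exponent of the GEV law and its threshold stability. -/

/-- `-log (1 - G)` for the distribution function `G` of the standard generalized extreme value
distribution for minima, at the points where `G < 1` (elsewhere the value is `0`). -/
noncomputable def gevMinExponent (ξ x : ℝ) : ℝ :=
  if ξ = 0 then Real.exp x else if 0 < 1 - ξ * x then (1 - ξ * x) ^ (-1 / ξ) else 0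

/-- The right inverse of `gevMinExponent ξ` on the positive reals. -/
noncomputable def gevMinQuantile (ξ w : ℝ) : ℝ :=
  if ξ = 0 then Real.log w else (1 - w ^ (-ξ)) / ξ

theorem gevMinExponent_nonneg (ξ x : ℝ) : 0 ≤ gevMinExponent ξ x := by
  unfold gevMinExponent
  split_ifs <;> positivity

theorem gevMinCDF_zero_one {ξ x : ℝ} (hx : ξ ≤ 0 ∨ ξ * x < 1) :
    gevMinCDF 0 1 ξ x = 1 - Real.exp (-gevMinExponent ξ x) := by
  unfold gevMinCDF gevMinExponent
  by_cases h0 : ξ = 0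
  · simp [h0]
  by_cases h1 : 0 < 1 - ξ * x
  · simp only [h0, if_false, sub_zero, div_one, h1, if_true]
  · have h2 : ¬ 0 < ξ := by
      rcases hx with h | h
      · exact not_lt.2 h
      · exact absurd (sub_pos.2 h) h1
    simp only [h0, if_false, sub_zero, div_one, h1, h2]
    simp

/-- For `ξ > 0` the default value `0` beyond the upper endpoint would break monotonicity, hence the
condition on `y`. For `ξ < 0` the default is the true limit at the lower endpoint. -/
theorem gevMinExponent_mono {ξ x y : ℝ} (hxy : x ≤ y) (hy : ξ ≤ 0 ∨ ξ * y < 1) :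
    gevMinExponent ξ x ≤ gevMinExponent ξ y := by
  rcases lt_trichotomy ξ 0 with h | h | h
  · have hm : 1 - ξ * x ≤ 1 - ξ * y := by nlinarith
    by_cases h1 : 0 < 1 - ξ * x
    · have h2 : 0 < 1 - ξ * y := h1.trans_le hm
      simp only [gevMinExponent, h.ne, if_false, h1, h2, if_true]
      exact Real.rpow_le_rpow h1.le hm (div_nonneg_of_nonpos (by norm_num) h.le)
    · have : gevMinExponent ξ x = 0 := by simp only [gevMinExponent, h.ne, if_false, h1]
      rw [this]
      exact gevMinExponent_nonneg _ _
  · simpa [gevMinExponent, h] using hxy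
  · have h2 : 0 < 1 - ξ * y := sub_pos.2 (hy.resolve_left (not_le.2 h))
    have hm : 1 - ξ * y ≤ 1 - ξ * x := by nlinarith
    have h1 : 0 < 1 - ξ * x := h2.trans_le hm
    simp only [gevMinExponent, h.ne', if_false, h1, h2, if_true]
    exact Real.rpow_le_rpow_of_nonpos h2 hm (div_nonpos_of_nonpos_of_nonneg (by norm_num) h.le)

theorem one_sub_mul_gevMinQuantile {ξ w : ℝ} (hξ : ξ ≠ 0) :
    1 - ξ * gevMinQuantile ξ w = w ^ (-ξ) := by
  simp only [gevMinQuantile, hξ, if_false]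
  field_simp
  ring

theorem mul_gevMinQuantile_lt_one {ξ w : ℝ} (hw : 0 < w) : ξ * gevMinQuantile ξ w < 1 := by
  by_cases hξ : ξ = 0
  · simp [hξ]
  · have := one_sub_mul_gevMinQuantile (w := w) hξ
    linarith [Real.rpow_pos_of_pos hw (-ξ)]

theorem gevMinExponent_gevMinQuantile {ξ w : ℝ} (hw : 0 < w) :
    gevMinExponent ξ (gevMinQuantile ξ w) = w := by
  by_cases hξ : ξ = 0
  · simp [gevMinExponent, gevMinQuantile, hξ, Real.exp_log hw]
  · have h : 0 < 1 - ξ * gevMinQuantile ξ w := sub_pos.2 (mul_gevMinQuantile_lt_one hw)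
    simp only [gevMinExponent, hξ, if_false, h, if_true]
    rw [one_sub_mul_gevMinQuantile hξ, ← Real.rpow_mul hw.le,
      show -ξ * (-1 / ξ) = 1 by field_simp, Real.rpow_one]

theorem one_sub_mul_pos_of_gevMinExponent_pos {ξ x : ℝ} (h : 0 < gevMinExponent ξ x) :
    0 < 1 - ξ * x := by
  by_cases hξ : ξ = 0
  · simp [hξ]
  · by_contra hx
    simp [gevMinExponent, hξ, hx] at h

/-- Threshold stability: above the point `x`, the exponent of the generalized extreme value
distribution decays like the tail of a generalized Pareto distribution. -/
theorem gevMinExponent_sub_mul {ξ x t : ℝ} (hx : 0 < 1 - ξ * x) {s : ℝ} (hs : 0 < s)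
    (ht : 0 < t) :
    gevMinExponent ξ (x - (1 - ξ * x) * t)
      = gevMinExponent ξ x * (1 - gpdCDF ξ s (s * t)) := by
  have hst : ¬ s * t ≤ 0 := not_le.2 (mul_pos hs ht)
  by_cases hξ : ξ = 0
  · have : -(s * t) / s = -t := by field_simp
    simp [gevMinExponent, gpdCDF, hξ, hst, this, ← Real.exp_add, sub_eq_add_neg]
  · have h1 : ξ * (s * t) / s = ξ * t := by field_simp
    have h2 : 1 - ξ * (x - (1 - ξ * x) * t) = (1 - ξ * x) * (1 + ξ * t) := by ring
    simp only [gevMinExponent, gpdCDF, hξ, hst, if_false, h1, h2, hx, if_true,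
      mul_pos_iff_of_pos_left hx]
    by_cases h3 : 0 < 1 + ξ * t
    · simp only [h3, if_true, sub_sub_cancel]
      exact Real.mul_rpow hx.le h3.le
    · simp [h3]

/-! ### From the law of the minimum to uniform convergence of `n F`. -/

/-- With `w = -n log (1 - p n)`, the bounds `1 - 1/t ≤ log t ≤ t - 1` at `t = 1 - p n` squeeze `n p
n` between `w / (1 + w / n)` and `w`. -/
theorem tendsto_nat_mul_of_tendsto_one_sub_pow {p : ℕ → ℝ} (h0 : ∀ n, 0 ≤ p n)
    (h1 : ∀ n, p n ≤ 1) {v : ℝ}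
    (h : Tendsto (fun n => (1 - p n) ^ n) atTop (𝓝 (Real.exp (-v)))) :
    Tendsto (fun n => n * p n) atTop (𝓝 v) := by
  have hw : Tendsto (fun n => -Real.log ((1 - p n) ^ n)) atTop (𝓝 v) := by
    have := (h.log (Real.exp_pos _).ne').neg
    rwa [Real.log_exp, neg_neg] at this
  have hlow : Tendsto (fun n : ℕ => -Real.log ((1 - p n) ^ n)
      / (1 + -Real.log ((1 - p n) ^ n) / n)) atTop (𝓝 v) := by
    have h2 := hw.div_atTop tendsto_natCast_atTop_atTop
    have h3 := hw.div (h2.const_add 1) (by norm_num)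
    rwa [add_zero, div_one] at h3
  have hev : ∀ᶠ n : ℕ in atTop, 0 < n ∧ 0 < 1 - p n := by
    filter_upwards [h.eventually_const_lt (Real.exp_pos _), eventually_gt_atTop 0] with n hn hn0
    refine ⟨hn0, lt_of_le_of_ne (sub_nonneg.2 (h1 n)) fun he => ?_⟩
    rw [← he, zero_pow hn0.ne'] at hn
    exact hn.false
  refine tendsto_of_tendsto_of_tendsto_of_le_of_le' hlow hw ?_ ?_
  · filter_upwards [hev] with n ⟨hn, hp⟩
    have hn' : (0 : ℝ) < n := Nat.cast_pos.2 hn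
    have hl : Real.log (1 - p n) ≤ 0 := Real.log_nonpos hp.le (by linarith [h0 n])
    have key : -Real.log (1 - p n) ≤ p n * (1 - Real.log (1 - p n)) := by
      have hlog := Real.add_one_le_exp (-Real.log (1 - p n))
      rw [Real.exp_neg, Real.exp_log hp, ← one_div, le_div_iff₀ hp] at hlog
      nlinarith
    rw [Real.log_pow, show -(n * Real.log (1 - p n)) / n = -Real.log (1 - p n) by field_simp,
      div_le_iff₀ (by linarith)]
    nlinarith
  · filter_upwards [hev] with n ⟨hn, hp⟩
    rw [Real.log_pow]
    have := Real.log_le_sub_one_of_pos hp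
    nlinarith [(Nat.cast_nonneg n : (0 : ℝ) ≤ n)]

theorem measureReal_iInf_fin_le {Ω : Type*} [MeasurableSpace Ω] {P : Measure Ω}
    [IsProbabilityMeasure P] {X : ℕ → Ω → ℝ} (hX : ∀ i, Measurable (X i))
    (hindep : iIndepFun X P) {z p : ℝ} (hp : ∀ i, P.real {ω | X i ω ≤ z} = p)
    {n : ℕ} (hn : 0 < n) :
    P.real {ω | (⨅ i : Fin n, X i ω) ≤ z} = 1 - (1 - p) ^ n := by
  have : Nonempty (Fin n) := ⟨⟨0, hn⟩⟩
  have hset : {ω | (⨅ i : Fin n, X i ω) ≤ z}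
      = (⋂ i ∈ Finset.range n, X i ⁻¹' Set.Ioi z)ᶜ := by
    ext ω
    simp only [Set.mem_ofPred_eq, Set.mem_compl_iff, Set.mem_iInter, Finset.mem_range,
      Set.mem_preimage, Set.mem_Ioi, not_forall, not_lt]
    constructor
    · intro h
      obtain ⟨i, hi⟩ := exists_eq_ciInf_of_finite (f := fun i : Fin n => X i ω)
      exact ⟨i, i.2, hi.trans_le h⟩
    · rintro ⟨i, hi, h⟩
      exact (ciInf_le (Set.finite_range _).bddBelow (⟨i, hi⟩ : Fin n)).trans h
  have hm : ∀ i, MeasurableSet (X i ⁻¹' Set.Ioi z) := fun i => hX i measurableSet_Ioi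
  have hone : ∀ i, P.real (X i ⁻¹' Set.Ioi z) = 1 - p := by
    intro i
    rw [← hp i, ← probReal_compl_eq_one_sub (measurableSet_le (hX i) measurable_const)]
    congr 1
    ext ω
    simp
  rw [hset, probReal_compl_eq_one_sub (Finset.measurableSet_biInter _ fun i _ => hm i)]
  congr 1
  rw [Measure.real, hindep.measure_inter_preimage_eq_mul (sets := fun _ => Set.Ioi z) _
    fun _ _ => measurableSet_Ioi,
    ENNReal.toReal_prod]
  calc ∏ i ∈ Finset.range n, (P (X i ⁻¹' Set.Ioi z)).toReal
      = ∏ _i ∈ Finset.range n, (1 - p) := Finset.prod_congr rfl fun i _ => hone i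
    _ = (1 - p) ^ n := by simp

/-- If nondecreasing functions `f n` converge pointwise to the exponent of a generalized extreme
value distribution, then they do so uniformly to the left of a point, and so does any sequence
lying between the left limits of the `f n` and the `f n`. -/
theorem eventually_gevMinExponent_bounds {ξ : ℝ} {f g : ℕ → ℝ → ℝ}
    (hg0 : ∀ n x, 0 ≤ g n x) (hmono : ∀ n, 1 ≤ n → Monotone (f n))
    (hfg : ∀ n, 1 ≤ n → ∀ x y, x < y → f n x ≤ g n y)
    (hlim : ∀ x, ξ * x < 1 → Tendsto (fun n => f n x) atTop (𝓝 (gevMinExponent ξ x)))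
    {B δ : ℝ} (hB : 0 < B) (hδ : 0 < δ) :
    ∀ᶠ n in atTop, ∀ x ≤ gevMinQuantile ξ B,
      gevMinExponent ξ x - δ ≤ g n x ∧ f n x ≤ gevMinExponent ξ x + δ := by
  -- The grid has step `η` in the values of the exponent. The lower bound loses up to three steps:
  -- two from rounding down to a grid point strictly left of `x`, one from the error there.
  set η := δ / 3 with hη
  have hη0 : 0 < η := by positivity
  obtain ⟨M, hM⟩ := exists_nat_gt (B / η)
  rw [div_lt_iff₀ hη0] at hM
  have hgrid : ∀ᶠ n in atTop, ∀ j ∈ Finset.Icc 1 M,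
      |f n (gevMinQuantile ξ (j * η)) - j * η| < η := by
    rw [Filter.eventually_all_finset]
    intro j hj
    have hj' : 0 < j * η := by
      have : 0 < j := (Finset.mem_Icc.1 hj).1
      positivity
    have := hlim _ (mul_gevMinQuantile_lt_one (ξ := ξ) hj')
    rw [gevMinExponent_gevMinQuantile hj', Metric.tendsto_nhds] at this
    exact this η hη0
  filter_upwards [hgrid, eventually_ge_atTop 1] with n hn hn1 x hx
  have hqB := mul_gevMinQuantile_lt_one (ξ := ξ) hB
  have hxD : ξ ≤ 0 ∨ ξ * x < 1 := by
    rcases le_or_gt ξ 0 with h | h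
    · exact .inl h
    · exact .inr (by nlinarith)
  have hw0 := gevMinExponent_nonneg ξ x
  have hwB : gevMinExponent ξ x ≤ B := by
    have := gevMinExponent_mono hx (.inr hqB)
    rwa [gevMinExponent_gevMinQuantile hB] at this
  set w := gevMinExponent ξ x
  set j := ⌊w / η⌋₊
  have hj1 : j * η ≤ w := (le_div_iff₀ hη0).1 (Nat.floor_le (by positivity))
  have hj2 : w < (j + 1) * η := (div_lt_iff₀ hη0).1 (Nat.lt_floor_add_one _)
  have hjM : j + 1 ≤ M := by
    have : (j : ℝ) * η < M * η := hj1.trans_lt (hwB.trans_lt hM)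
    exact_mod_cast lt_of_mul_lt_mul_right this hη0.le
  constructor
  · rcases lt_or_ge j 2 with h | h
    · have : (j : ℝ) ≤ 1 := by exact_mod_cast Nat.lt_succ_iff.1 h
      nlinarith [hg0 n x]
    · obtain ⟨k, hk⟩ : ∃ k, j = k + 1 := ⟨j - 1, by omega⟩
      have hk1 : (j : ℝ) = k + 1 := by exact_mod_cast hk
      have hkη : 0 < (k : ℝ) * η := by
        have : 0 < k := by omega
        positivity
      have hlt : gevMinQuantile ξ (k * η) < x := by
        by_contra hle
        have := gevMinExponent_mono (not_lt.1 hle) (.inr (mul_gevMinQuantile_lt_one hkη))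
        rw [gevMinExponent_gevMinQuantile hkη] at this
        nlinarith
      have h1 := hfg n hn1 _ _ hlt
      have h2 := (abs_lt.1 (hn k (Finset.mem_Icc.2 (by omega)))).1
      nlinarith
  · have hjη : 0 < ((j + 1 : ℕ) : ℝ) * η := by positivity
    have hle : x ≤ gevMinQuantile ξ ((j + 1 : ℕ) * η) := by
      by_contra hlt
      have := gevMinExponent_mono (not_le.1 hlt).le hxD
      rw [gevMinExponent_gevMinQuantile hjη] at this
      push_cast at this
      linarith
    have h1 := hmono n hn1 hle
    have h2 := (abs_lt.1 (hn (j + 1) (Finset.mem_Icc.2 (by omega)))).2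
    push_cast at h1 h2
    linarith

/-! ### Conditional tails as ratios, and the main theorem. -/

/-- As `a' = b' * r`, the error is `((a - a') - r * (b - b')) / b`, so only `b` needs a lower bound.
-/
theorem abs_div_sub_le_of_abs_sub_le {a b a' b' r δ c : ℝ} (hc : 0 < c) (hb : c ≤ b)
    (ha' : a' = b' * r) (hr0 : 0 ≤ r) (hr1 : r ≤ 1) (ha : |a - a'| ≤ δ) (hbb : |b - b'| ≤ δ) :
    |a / b - r| ≤ 2 * δ / c := by
  have hb0 : 0 < b := hc.trans_le hb
  have h : a / b - r = ((a - a') - r * (b - b')) / b := by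
    rw [ha']
    field_simp
    ring
  have hδ : 0 ≤ δ := (abs_nonneg _).trans ha
  rw [h, abs_div, abs_of_pos hb0]
  refine div_le_div₀ (by positivity) ?_ hc hb
  calc |(a - a') - r * (b - b')| ≤ |a - a'| + |r * (b - b')| := abs_sub _ _
    _ ≤ δ + 1 * δ := by
      rw [abs_mul, abs_of_nonneg hr0]
      gcongr
    _ = 2 * δ := by ring

theorem gpdCDF_mem_Icc (ξ : ℝ) {s : ℝ} (hs : 0 < s) (y : ℝ) :
    gpdCDF ξ s y ∈ Set.Icc (0 : ℝ) 1 := by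
  unfold gpdCDF
  split_ifs with h1 h2 h3
  · simp
  · have : Real.exp (-y / s) ≤ 1 := by
      rw [Real.exp_le_one_iff]
      exact div_nonpos_of_nonpos_of_nonneg (by linarith) hs.le
    exact ⟨by linarith, by linarith [Real.exp_pos (-y / s)]⟩
  · have hy : 0 < y / s := div_pos (not_le.1 h1) hs
    rw [mul_div_assoc] at h3 ⊢
    have : (1 + ξ * (y / s)) ^ (-1 / ξ) ≤ 1 := by
      rcases lt_or_gt_of_ne h2 with h | h
      · exact Real.rpow_le_one h3.le (by nlinarith)
          (div_nonneg_of_nonpos (by norm_num) h.le)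
      · exact Real.rpow_le_one_of_one_le_of_nonpos (by nlinarith)
          (div_nonpos_of_nonpos_of_nonneg (by norm_num) h.le)
    exact ⟨by linarith, by linarith [Real.rpow_nonneg h3.le (-1 / ξ)]⟩
  · simp

theorem cond_real_shortfall_lt {Ω : Type*} [MeasurableSpace Ω] {P : Measure Ω}
    [IsFiniteMeasure P] {X : Ω → ℝ} (hX : Measurable X) {u y : ℝ}
    (hu : 0 < P.real {ω | X ω < u}) (hy : 0 < y) :
    (P[|{ω | X ω < u}]).real {ω | u - X ω < y}
      = 1 - P.real {ω | X ω ≤ u - y} / P.real {ω | X ω < u} := by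
  rw [Measure.real, cond_apply (measurableSet_lt hX measurable_const), ENNReal.toReal_mul,
    ENNReal.toReal_inv, ← Measure.real, ← Measure.real]
  have : {ω | X ω < u} ∩ {ω | u - X ω < y} = {ω | X ω < u} \ {ω | X ω ≤ u - y} := by
    ext ω
    simp only [Set.mem_inter_iff, Set.mem_ofPred_eq, Set.mem_sdiff, not_le, and_congr_right_iff]
    intro _
    constructor <;> intro h <;> linarith
  have hsub : {ω | X ω ≤ u - y} ⊆ {ω | X ω < u} := fun ω (h : X ω ≤ u - y) =>
    (by linarith : X ω < u)
  rw [this, measureReal_sdiff hsub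
    (measurableSet_le hX measurable_const)]
  field_simp

theorem theorem1 {Ω : Type*} [MeasurableSpace Ω] (P : Measure Ω) [IsProbabilityMeasure P]
    (X : ℕ → Ω → ℝ) (hX : ∀ i, Measurable (X i)) (hindep : iIndepFun X P)
    (F : ℝ → ℝ) (hF : ∀ i x, P.real {ω | X i ω ≤ x} = F x)
    (ξ : ℝ) (μ σ : ℕ → ℝ) (hσ : ∀ n, 1 ≤ n → 0 < σ n)
    (hGEV : ∀ x : ℝ, Tendsto
      (fun n : ℕ => P.real {ω | (⨅ i : Fin n, X i ω) ≤ μ n + σ n * x})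
      atTop (𝓝 (gevMinCDF 0 1 ξ x))) :
    ∀ i : ℕ, ∀ c C : ℝ, 0 < c → ∀ ε : ℝ, 0 < ε →
      ∃ u₀ : ℝ, 0 < P.real {ω | X i ω < u₀} ∧
        ∀ u : ℝ, u ≤ u₀ → 0 < P.real {ω | X i ω < u} →
          ∀ n : ℕ, c ≤ n * P.real {ω | X i ω < u} → n * P.real {ω | X i ω < u} ≤ C →
            0 < gpdScale (μ n) (σ n) ξ u ∧
            ∀ y : ℝ,
              |(P[|{ω | X i ω < u}]).real {ω | u - X i ω < y}
                - gpdCDF ξ (gpdScale (μ n) (σ n) ξ u) y| ≤ ε := by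
  intro i c C hc ε hε
  set g : ℝ → ℝ := fun x => P.real {ω | X i ω < x}
  have hgX : ∀ x, P.real {ω | X i ω < x} = g x := fun _ => rfl
  have hF0 : ∀ x, 0 ≤ F x := fun x => hF i x ▸ measureReal_nonneg
  have hF1 : ∀ x, F x ≤ 1 := fun x => hF i x ▸ measureReal_le_one
  have hFm : Monotone F := fun x y hxy => by
    rw [← hF i, ← hF i]
    exact measureReal_mono fun ω (h : X i ω ≤ x) => h.trans hxy
  have hgF : ∀ x, g x ≤ F x := fun x => by
    rw [← hF i]
    exact measureReal_mono fun ω (h : X i ω < x) => h.le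
  have hFg : ∀ x y, x < y → F x ≤ g y := fun x y hxy => by
    rw [← hF i]
    exact measureReal_mono fun ω (h : X i ω ≤ x) => h.trans_lt hxy
  have hgm : Monotone g := fun x y hxy =>
    measureReal_mono fun ω (h : X i ω < x) => h.trans_le hxy
  have hlim : ∀ x, ξ * x < 1 →
      Tendsto (fun n : ℕ => n * F (μ n + σ n * x)) atTop (𝓝 (gevMinExponent ξ x)) := by
    intro x hx
    refine tendsto_nat_mul_of_tendsto_one_sub_pow (fun _ => hF0 _) (fun _ => hF1 _) ?_
    have h := (hGEV x).const_sub 1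
    rw [gevMinCDF_zero_one (.inr hx), sub_sub_cancel] at h
    refine h.congr' ?_
    filter_upwards [eventually_gt_atTop 0] with n hn
    rw [measureReal_iInf_fin_le hX hindep (fun j => hF j _) hn, sub_sub_cancel]
  have hunif : ∀ B δ : ℝ, 0 < B → 0 < δ → ∀ᶠ n : ℕ in atTop, ∀ x ≤ gevMinQuantile ξ B,
      gevMinExponent ξ x - δ ≤ n * g (μ n + σ n * x) ∧
        n * F (μ n + σ n * x) ≤ gevMinExponent ξ x + δ := by
    intro B δ hB hδ
    refine eventually_gevMinExponent_bounds (f := fun n x => n * F (μ n + σ n * x))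
      (g := fun n x => n * g (μ n + σ n * x)) (fun n x => ?_) (fun n hn x y hxy => ?_)
      (fun n hn x y hxy => ?_) hlim hB hδ
    · exact mul_nonneg n.cast_nonneg measureReal_nonneg
    · have := hσ n hn
      exact mul_le_mul_of_nonneg_left (hFm (by gcongr)) n.cast_nonneg
    · have := hσ n hn
      exact mul_le_mul_of_nonneg_left (hFg _ _ (by gcongr)) n.cast_nonneg
  have hsmall : ∀ η : ℝ, 0 < η → ∃ u, 0 < g u ∧ g u < η := by
    intro η hη
    obtain ⟨k, hk⟩ := exists_nat_gt (2 / η)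
    -- Where the exponent is `1`, both `n * g` and `n * F` lie in `[1/2, 3/2]` for large `n`, so `g`
    -- is positive there and below `2 / n`.
    obtain ⟨n, hn, hkn⟩ := ((hunif 1 (1 / 2) one_pos (by norm_num)).and
      (eventually_ge_atTop (k + 1))).exists
    have hn0 : (0 : ℝ) < n := by exact_mod_cast (Nat.succ_pos k).trans_le hkn
    obtain ⟨h1, h2⟩ := hn _ le_rfl
    rw [gevMinExponent_gevMinQuantile one_pos] at h1 h2
    refine ⟨μ n + σ n * gevMinQuantile ξ 1, pos_of_mul_pos_right (by linarith) hn0.le, ?_⟩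
    have hkn' : (k : ℝ) ≤ n := by exact_mod_cast (Nat.le_succ k).trans hkn
    have h3 : 2 < n * η := (div_lt_iff₀ hη).1 (hk.trans_le hkn')
    have h4 := mul_le_mul_of_nonneg_left (hgF (μ n + σ n * gevMinQuantile ξ 1)) hn0.le
    exact lt_of_mul_lt_mul_left (by linarith) hn0.le
  rcases lt_or_ge C c with hCc | hcC
  · obtain ⟨u, hu, -⟩ := hsmall 1 one_pos
    exact ⟨u, hu, fun v _ _ n h1 h2 => absurd (h1.trans h2) (not_le.2 hCc)⟩
  have hC : 0 < C := hc.trans_le hcC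
  -- The term `c / 2` keeps the exponent at `x` positive, hence the GPD scale too; `ε * c / 2` turns
  -- the ratio error `2 * δ / c` into at most `ε`.
  set δ := min (c / 2) (ε * c / 2) with hδ
  have hδ0 : 0 < δ := by positivity
  have hB : 0 < 2 * C := by positivity
  -- Eventually `n * F` exceeds `C` at the point with exponent `2 * C`, so `n * g u ≤ C` places `u`
  -- at or left of that point.
  have hloc := (hlim _ (mul_gevMinQuantile_lt_one hB)).eventually_const_lt
    (show C < gevMinExponent ξ (gevMinQuantile ξ (2 * C)) by
      rw [gevMinExponent_gevMinQuantile hB]; linarith)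
  obtain ⟨N, hN⟩ := eventually_atTop.1 ((hunif _ δ hB hδ0).and hloc)
  -- For `u ≤ u₀`, the bound `c ≤ n * g u` then forces `n > N + 1`.
  obtain ⟨u₀, hu₀, hu₀N⟩ := hsmall (c / (N + 1)) (by positivity)
  refine ⟨u₀, hu₀, fun u hu hgu n hcn hnC => ?_⟩
  rw [hgX] at hgu hcn hnC
  have hguN : g u * (N + 1) < c := (lt_div_iff₀ (by positivity)).1 ((hgm hu).trans_lt hu₀N)
  have hNn : N + 1 ≤ n := by
    have : ((N : ℝ) + 1) * g u < n * g u := by linarith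
    exact_mod_cast (lt_of_mul_lt_mul_right this hgu.le).le
  have hn0 : (0 : ℝ) < n := by exact_mod_cast (Nat.succ_pos N).trans_le hNn
  have hσn : 0 < σ n := hσ n ((Nat.succ_pos N).trans_le hNn)
  obtain ⟨hbd, hlocn⟩ := hN n ((Nat.le_succ N).trans hNn)
  obtain ⟨x, rfl⟩ : ∃ x, u = μ n + σ n * x := ⟨(u - μ n) / σ n, by field_simp; ring⟩
  have hx : x ≤ gevMinQuantile ξ (2 * C) := by
    by_contra hlt
    have := mul_le_mul_of_nonneg_left (hFg (μ n + σ n * gevMinQuantile ξ (2 * C))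
      (μ n + σ n * x) (by gcongr; exact not_le.1 hlt)) hn0.le
    linarith
  have hng : |n * g (μ n + σ n * x) - gevMinExponent ξ x| ≤ δ := by
    have h := mul_le_mul_of_nonneg_left (hgF (μ n + σ n * x)) hn0.le
    obtain ⟨h1, h2⟩ := hbd x hx
    exact abs_le.2 ⟨by linarith, by linarith⟩
  have hxpos : 0 < 1 - ξ * x := by
    apply one_sub_mul_pos_of_gevMinExponent_pos
    have := (abs_le.1 hng).2
    have : δ ≤ c / 2 := min_le_left _ _
    linarith
  have hscale : gpdScale (μ n) (σ n) ξ (μ n + σ n * x) = σ n * (1 - ξ * x) := by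
    unfold gpdScale
    ring
  have hs : 0 < gpdScale (μ n) (σ n) ξ (μ n + σ n * x) := hscale ▸ mul_pos hσn hxpos
  refine ⟨hs, fun y => ?_⟩
  set s := gpdScale (μ n) (σ n) ξ (μ n + σ n * x)
  rcases le_or_gt y 0 with hy | hy
  · rw [Measure.real, cond_apply (measurableSet_lt (hX i) measurable_const)]
    have : {ω | X i ω < μ n + σ n * x} ∩ {ω | μ n + σ n * x - X i ω < y} = ∅ := by
      ext ω
      simp only [Set.mem_inter_iff, Set.mem_ofPred_eq, Set.mem_empty_iff_false, iff_false,
        not_and, not_lt]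
      intro h
      linarith
    simpa [this, gpdCDF, hy] using hε.le
  · have ht : 0 < y / s := div_pos hy hs
    have hsy : s * (y / s) = y := by field_simp
    have hz : μ n + σ n * x - y = μ n + σ n * (x - (1 - ξ * x) * (y / s)) := by
      have : σ n * (1 - ξ * x) * (y / s) = y := by rw [← hscale]; exact hsy
      linarith
    have hexp := gevMinExponent_sub_mul hxpos hs ht
    rw [hsy] at hexp
    obtain ⟨h1, h2⟩ := hbd (x - (1 - ξ * x) * (y / s))
      ((sub_le_self _ (mul_pos hxpos ht).le).trans hx)
    have h3 := mul_le_mul_of_nonneg_left (hgF (μ n + σ n * (x - (1 - ξ * x) * (y / s)))) hn0.le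
    obtain ⟨hH0, hH1⟩ := gpdCDF_mem_Icc ξ hs y
    have key := abs_div_sub_le_of_abs_sub_le
      (a := n * F (μ n + σ n * (x - (1 - ξ * x) * (y / s)))) hc hcn hexp
      (sub_nonneg.2 hH1) (by linarith)
      (abs_le.2 ⟨by linarith, by linarith⟩) hng
    rw [cond_real_shortfall_lt (hX i) hgu hy, hF, hgX, hz, abs_sub_comm]
    rw [mul_div_mul_left _ _ hn0.ne'] at key
    calc _ = |F (μ n + σ n * (x - (1 - ξ * x) * (y / s))) / g (μ n + σ n * x)
          - (1 - gpdCDF ξ s y)| := by congr 1; ring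
      _ ≤ 2 * δ / c := key
      _ ≤ ε := by
        rw [div_le_iff₀ hc]
        linarith [min_le_right (c / 2) (ε * c / 2)]
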